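/- Let $d\ge 0$ be an integer, let $G$ be a graph with vertex set $\mathbb Z^d$ (for instance the nearest-neighbour graph or a spread-out graph), let $p\in[0,1]$ (for instance the critical parameter of $G$), and let $\mathbb P$, with expectation $\mathbb E$, be the law of Bernoulli bond percolation on $G$ with parameter $p$: each edge of $G$ is open with probability $p$, independently of the other edges. For a (not necessarily finite) set $\Lambda\subset\mathbb Z^d$ and $x\in\Lambda$, let $\mathcal C(x;\Lambda)$ be the cluster of $x$ created by the open edges with both endpoints in $\Lambda$, and let $\tau_\Lambda(x,y)=\mathbb P(y\in\mathcal C(x;\Lambda))$ for $x,y\in\Lambda$. For $h:\Lambda\times\Lambda\to[0,\infty)$ and $\varphi:\Lambda\to[0,\infty)$ write $h*\varphi(x)=\sum_{y\in\Lambda}h(x,y)\varphi(y)$ for $x\in\Lambda$. **Theorem.** For every $C>0$ there is a constant $\lambda=\lambda(C)>0$, depending only on $C$, with the following property. Let $d$, $G$, $p$ be as above, let $\Lambda\subset\mathbb Z^d$ and $\varphi:\Lambda\to[0,\infty)$, and suppose that there is a function $h:\Lambda\times\Lambda\to[0,\infty)$ such that 1. $\tau_\Lambda(x,y)\le h(x,y)$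 for all $x,y\in\Lambda$; 2. $\sup_{x\in\Lambda}h*\varphi(x)\le 1$; 3. $\sum_{y\in\Lambda}h(x,y)\,(h*\varphi(y))^2\le C\cdot h*\varphi(x)$ for all $x\in\Lambda$. Then, for every $x\in\Lambda$, $$\mathbb E\Big[\exp\Big(\lambda\sum_{y\in\mathcal C(x;\Lambda)}\varphi(y)\Big)\Big]\le 1+h*\varphi(x).$$ -/

import Mathlib

open MeasureTheory ProbabilityTheory
open scoped ENNReal NNReal

noncomputable section

namespace Percolation

/-- The law of Bernoulli bond percolation with parameter `p` on the graph `G` with vertex set `ℤ^d`: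
a configuration is the set of open edges, and each edge of `G` is open with probability `p`,
independently of the other edges. -/
def bondMeasure {d : ℕ} (G : SimpleGraph (Fin d → ℤ)) (p : unitInterval) :
    Measure (Set (Sym2 (Fin d → ℤ))) :=
  setBernoulli G.edgeSet p

/-- The graph with vertex set `Λ` whose edges are the edges of `G` that are open in `ω` and have
both endpoints in `Λ`. -/
def openGraph {d : ℕ} (G : SimpleGraph (Fin d → ℤ)) (Λ : Set (Fin d → ℤ))
    (ω : Set (Sym2 (Fin d → ℤ))) : SimpleGraph Λ :=
  (G ⊓ SimpleGraph.fromEdgeSet ω).induce Λ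

/-- The cluster `C(x; Λ)`: all `y ∈ Λ` joined to `x` by a path of open edges with both endpoints
in `Λ`. -/
def cluster {d : ℕ} (G : SimpleGraph (Fin d → ℤ)) (Λ : Set (Fin d → ℤ))
    (ω : Set (Sym2 (Fin d → ℤ))) (x : Λ) : Set Λ :=
  {y | (openGraph G Λ ω).Reachable x y}

/-- The restricted two-point function `τ_Λ(x, y)`: the probability that `x` and `y` are connected
by a path of open edges inside `Λ`. -/
def tau {d : ℕ} (G : SimpleGraph (Fin d → ℤ)) (p : unitInterval) (Λ : Set (Fin d → ℤ))
    (x y : Λ) : ℝ≥0∞ :=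
  bondMeasure G p {ω | y ∈ cluster G Λ ω x}

/-- `h * φ (x) = ∑_{y ∈ Λ} h(x, y) φ(y)`, a sum of nonnegative terms, with value in `[0, ∞]`. -/
def conv {d : ℕ} {Λ : Set (Fin d → ℤ)} (h : Λ → Λ → ℝ≥0) (φ : Λ → ℝ≥0) (x : Λ) : ℝ≥0∞ :=
  ∑' y : Λ, (h x y : ℝ≥0∞) * (φ y : ℝ≥0∞)

/-- `∑_{y ∈ C(x; Λ)} φ(y)`, with value in `[0, ∞]`. -/
def clusterSum {d : ℕ} (G : SimpleGraph (Fin d → ℤ)) (Λ : Set (Fin d → ℤ))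
    (φ : Λ → ℝ≥0) (ω : Set (Sym2 (Fin d → ℤ))) (x : Λ) : ℝ≥0∞ :=
  ∑' y : cluster G Λ ω x, (φ y : ℝ≥0∞)

end Percolation

end

namespace Percolation

/-! Since `h` dominates `τ_Λ` and `τ_Λ(y, y) = 1`, hypothesis 2 gives `φ ≤ 1`. For `a ≤ 1` one has
`e^a ≤ 1 + 2a`, so with `ε = 2λ` the exponential is at most `∏_{y ∈ C(x)} (1 + ε φ(y))`, the sum of
`∏_{y ∈ S} ε φ(y)` over finite `S ⊆ C(x)` (`exp_clusterSum_le`). Its expectation is a generating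
function of the probabilities that `x` is connected to all of `S`.

If `|S| ≥ 2`, such a connection branches: for some `v` and some partition `S = A ∪ B`, the
connections from `x` to `v`, `v` to `A` and `v` to `B` use disjoint edges (`exists_branch`). The van
den Berg–Kesten inequality (`listExp_disjointSup_le`) bounds the probability by a sum of products of
three factors. Summing over `S`, the generating function `g` satisfies `g ≤ ε h*φ + h*(g²)`.
Hypothesis 3 shows that the bound `g ≤ 2ε h*φ` reproduces itself when `4εC ≤ 1` (`connGen_le`).

All this is done for finitely many edges and for `|S| ≤ n`, by induction on `n`; monotone limits
then give the full statement (`tsum_prod_mul_bondMeasure_le`). -/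

/-- The expectation of `f ω`, where `ω` is the random subset of the list `l` that contains each
`e ∈ l` with weight `w e` and omits it with weight `w' e`, independently. -/
noncomputable def listExp {ι : Type*} (w w' : ι → ℝ≥0∞) : List ι → (Set ι → ℝ≥0∞) → ℝ≥0∞
  | [], f => f ∅
  | e :: l, f => w' e * listExp w w' l f + w e * listExp w w' l (fun ω => f (insert e ω))

/-- The largest value of `f` on pairs of disjoint subsets covering `ω`. -/
noncomputable def disjointSup {ι : Type*} (f : Set ι → Set ι → ℝ≥0∞) (ω : Set ι) : ℝ≥0∞ :=
  ⨆ (I : Set ι) (_ : I ⊆ ω), f I (ω \ I)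

/-! ### The van den Berg–Kesten inequality for finitely many edges. -/

section listExp

variable {ι : Type*} {w w' : ι → ℝ≥0∞}

lemma listExp_mono (l : List ι) {f g : Set ι → ℝ≥0∞} (h : ∀ ω : Set ι, ω.Finite → f ω ≤ g ω) :
    listExp w w' l f ≤ listExp w w' l g := by
  induction l generalizing f g with
  | nil => exact h _ Set.finite_empty
  | cons e l ih =>
    simp only [listExp]
    gcongr
    · exact ih h
    · exact ih fun ω hω => h _ (hω.insert e)

lemma listExp_add (l : List ι) (f g : Set ι → ℝ≥0∞) :
    listExp w w' l (fun ω => f ω + g ω) = listExp w w' l f + listExp w w' l g := by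
  induction l generalizing f g with
  | nil => rfl
  | cons e l ih =>
    simp only [listExp, ih]
    ring

lemma listExp_const_mul (l : List ι) (a : ℝ≥0∞) (f : Set ι → ℝ≥0∞) :
    listExp w w' l (fun ω => a * f ω) = a * listExp w w' l f := by
  induction l generalizing f with
  | nil => rfl
  | cons e l ih =>
    simp only [listExp, ih]
    ring

lemma listExp_mul_const (l : List ι) (a : ℝ≥0∞) (f : Set ι → ℝ≥0∞) :
    listExp w w' l (fun ω => f ω * a) = listExp w w' l f * a := by
  simp only [mul_comm _ a, listExp_const_mul]

lemma listExp_tsum {α : Type*} (l : List ι) (f : α → Set ι → ℝ≥0∞) :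
    listExp w w' l (fun ω => ∑' a, f a ω) = ∑' a, listExp w w' l (f a) := by
  induction l generalizing f with
  | nil => rfl
  | cons e l ih =>
    simp only [listExp, ih, ENNReal.tsum_add, ENNReal.tsum_mul_left]

lemma disjointSup_mono {f : Set ι → Set ι → ℝ≥0∞} (hf : ∀ I, Monotone (f I)) :
    Monotone (disjointSup f) := by
  intro ω ω' h
  refine iSup₂_le fun I hI => ?_
  exact (hf I (Set.sdiff_subset_sdiff_left h)).trans
    (le_iSup₂_of_le (f := fun (I : Set ι) (_ : I ⊆ ω') => f I (ω' \ I)) I (hI.trans h) le_rfl)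

/-- The element `e` can serve only one of the two disjoint sets, so it is handed either to `I` or to
`J`. -/
lemma disjointSup_insert_le {f : Set ι → Set ι → ℝ≥0∞} (hf₁ : ∀ J, Monotone fun I => f I J)
    (hf₂ : ∀ I, Monotone (f I)) (e : ι) (ω : Set ι) :
    disjointSup f (insert e ω) ≤
      disjointSup (fun I J => f (insert e I) J ⊔ f I (insert e J)) ω := by
  refine iSup₂_le fun I hI => ?_
  by_cases he : e ∈ I
  · refine le_iSup₂_of_le (f := fun (I : Set ι) (_ : I ⊆ ω) =>
      f (insert e I) (ω \ I) ⊔ f I (insert e (ω \ I))) (I ∩ ω) Set.inter_subset_right ?_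
    refine le_sup_of_le_left ((hf₁ _ ?_).trans (hf₂ _ ?_))
    · intro y hy
      rcases hI hy with rfl | h
      · exact Set.mem_insert _ _
      · exact Set.mem_insert_of_mem _ ⟨hy, h⟩
    · rintro y ⟨rfl | h, hy⟩
      · exact absurd he hy
      · exact ⟨h, fun h' => hy h'.1⟩
  · refine le_iSup₂_of_le (f := fun (I : Set ι) (_ : I ⊆ ω) =>
      f (insert e I) (ω \ I) ⊔ f I (insert e (ω \ I))) I ?_ ?_
    · intro y hy
      rcases hI hy with rfl | h
      · exact absurd hy he
      · exact h
    · refine le_sup_of_le_right (hf₂ _ ?_)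
      rintro y ⟨rfl | h, hy⟩
      · exact Set.mem_insert _ _
      · exact Set.mem_insert_of_mem _ ⟨h, hy⟩

/-- The van den Berg–Kesten inequality, for monotone functions of two configurations. -/
theorem listExp_disjointSup_le (hw : ∀ e, w e + w' e = 1) (l : List ι)
    {f : Set ι → Set ι → ℝ≥0∞} (hf₁ : ∀ J, Monotone fun I => f I J)
    (hf₂ : ∀ I, Monotone (f I)) :
    listExp w w' l (disjointSup f) ≤ listExp w w' l (fun I => listExp w w' l (f I)) := by
  induction l generalizing f with
  | nil =>
    simp only [listExp]
    refine iSup₂_le fun I hI => ?_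
    rw [Set.subset_empty_iff.1 hI, Set.sdiff_empty]
  | cons e l ih =>
    set E : (Set ι → Set ι → ℝ≥0∞) → ℝ≥0∞ :=
      fun f => listExp w w' l (fun I => listExp w w' l (f I)) with hE
    set f10 : Set ι → Set ι → ℝ≥0∞ := fun I J => f (insert e I) J
    set f01 : Set ι → Set ι → ℝ≥0∞ := fun I J => f I (insert e J)
    set f11 : Set ι → Set ι → ℝ≥0∞ := fun I J => f (insert e I) (insert e J)
    have hins : Monotone fun I : Set ι => insert e I := fun _ _ h => Set.insert_subset_insert h
    have E_mono : ∀ {a b : Set ι → Set ι → ℝ≥0∞}, (∀ I J, a I J ≤ b I J) → E a ≤ E b :=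
      fun h => listExp_mono _ fun I _ => listExp_mono _ fun J _ => h I J
    have E_add : ∀ a b : Set ι → Set ι → ℝ≥0∞, E (fun I J => a I J + b I J) = E a + E b := by
      intro a b
      simp only [hE, listExp_add]
    have h0 : listExp w w' l (disjointSup f) ≤ E f := ih hf₁ hf₂
    -- The maximum of `f10` and `f01` is in general not a product even if `f` is one; this is why
    -- the induction runs over all monotone functions of two configurations.
    have h1 : listExp w w' l (fun ω => disjointSup f (insert e ω)) ≤
        E (fun I J => f10 I J ⊔ f01 I J) := by
      refine (listExp_mono _ fun ω _ => disjointSup_insert_le hf₁ hf₂ e ω).trans (ih ?_ ?_)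
      · exact fun J I I' h => sup_le_sup (hf₁ _ (hins h)) (hf₁ _ h)
      · exact fun I J J' h => sup_le_sup (hf₂ _ h) (hf₂ _ (hins h))
    -- Pointwise, `f10 + f01` is the maximum plus the minimum of the two, and the minimum is at
    -- least `f` by monotonicity.
    have h2 : E (fun I J => f10 I J ⊔ f01 I J) + E f ≤ E f10 + E f01 := by
      rw [← E_add, ← E_add]
      refine E_mono fun I J => ?_
      have ha : f I J ≤ f10 I J := hf₁ _ (Set.subset_insert _ _)
      have hb : f I J ≤ f01 I J := hf₂ _ (Set.subset_insert _ _)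
      rcases le_total (f10 I J) (f01 I J) with h | h
      · rw [sup_eq_right.2 h, add_comm]
        gcongr
      · rw [sup_eq_left.2 h]
        gcongr
    have h3 : E (fun I J => f10 I J ⊔ f01 I J) ≤ E f11 :=
      E_mono fun I J => sup_le (hf₂ _ (Set.subset_insert _ _)) (hf₁ _ (Set.subset_insert _ _))
    have hexp : listExp w w' (e :: l) (fun I => listExp w w' (e :: l) (f I)) =
        w' e * (w' e * E f + w e * E f01) + w e * (w' e * E f10 + w e * E f11) := by
      simp only [listExp, listExp_add, listExp_const_mul, hE, f10, f01, f11]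
    rw [hexp]
    simp only [listExp]
    set s := E (fun I J => f10 I J ⊔ f01 I J)
    -- Multiplying by `w e + w' e = 1` produces the cross term `w e * w' e * (s + E f)`, to which
    -- `h2` applies; `h3` handles the term where both copies of `e` are open.
    calc w' e * listExp w w' l (disjointSup f)
          + w e * listExp w w' l (fun ω => disjointSup f (insert e ω))
        ≤ w' e * E f + w e * s := by gcongr
      _ = (w e + w' e) * (w' e * E f) + (w e + w' e) * (w e * s) := by simp [hw]
      _ = w' e * (w' e * E f) + w e * w' e * (s + E f) + w e * (w e * s) := by ring
      _ ≤ w' e * (w' e * E f) + w e * w' e * (E f10 + E f01) + w e * (w e * E f11) := by gcongr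
      _ = _ := by ring

/-- The van den Berg–Kesten inequality for a product of monotone functions. -/
theorem listExp_disjointSup_mul_le (hw : ∀ e, w e + w' e = 1) (l : List ι)
    {a b : Set ι → ℝ≥0∞} (ha : Monotone a) (hb : Monotone b) :
    listExp w w' l (disjointSup fun I J => a I * b J) ≤ listExp w w' l a * listExp w w' l b := by
  refine (listExp_disjointSup_le hw l (fun J I I' h => ?_) (fun I J J' h => ?_)).trans_eq ?_
  · exact mul_le_mul_left (ha h) _
  · exact mul_le_mul_right (hb h) _
  · simp only [listExp_const_mul, listExp_mul_const]

end listExp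

/-! ### Deterministic part: branching of a connection. -/

section Branch

variable {d : ℕ} {G : SimpleGraph (Fin d → ℤ)} {Λ : Set (Fin d → ℤ)}

lemma openGraph_adj {ω : Set (Sym2 (Fin d → ℤ))} {u v : Λ} :
    (openGraph G Λ ω).Adj u v ↔ G.Adj u v ∧ s((u : Fin d → ℤ), (v : Fin d → ℤ)) ∈ ω := by
  simp only [openGraph, SimpleGraph.comap_adj, SimpleGraph.inf_adj, SimpleGraph.fromEdgeSet_adj,
    Function.Embedding.subtype_apply]
  exact ⟨fun h => ⟨h.1, h.2.1⟩, fun h => ⟨h.1, h.2, h.1.ne⟩⟩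

lemma cluster_mono (x : Λ) {ω ω' : Set (Sym2 (Fin d → ℤ))} (h : ω ⊆ ω') :
    cluster G Λ ω x ⊆ cluster G Λ ω' x := fun _ hy =>
  SimpleGraph.Reachable.mono
    (fun _ _ hab => openGraph_adj.2 ⟨(openGraph_adj.1 hab).1, h (openGraph_adj.1 hab).2⟩) hy

lemma mem_cluster_self (ω : Set (Sym2 (Fin d → ℤ))) (x : Λ) : x ∈ cluster G Λ ω x :=
  SimpleGraph.Reachable.refl _

lemma mem_cluster_of_adj {ω : Set (Sym2 (Fin d → ℤ))} {x u v : Λ} (hu : u ∈ cluster G Λ ω x)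
    (h : (openGraph G Λ ω).Adj u v) : v ∈ cluster G Λ ω x :=
  SimpleGraph.Reachable.trans hu h.reachable

lemma mem_cluster_trans {ω : Set (Sym2 (Fin d → ℤ))} {x u v : Λ} (hu : u ∈ cluster G Λ ω x)
    (h : v ∈ cluster G Λ ω u) : v ∈ cluster G Λ ω x :=
  SimpleGraph.Reachable.trans hu h

lemma cluster_induction {ω : Set (Sym2 (Fin d → ℤ))} {x : Λ} {P : Λ → Prop} (hx : P x)
    (hstep : ∀ u v, u ∈ cluster G Λ ω x → P u → (openGraph G Λ ω).Adj u v → P v)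
    {y : Λ} (hy : y ∈ cluster G Λ ω x) : P y := by
  have hy' : (openGraph G Λ ω).Reachable x y := hy
  rw [SimpleGraph.reachable_iff_reflTransGen] at hy'
  induction hy' with
  | refl => exact hx
  | tail hab hbc ih =>
    have hb := (SimpleGraph.reachable_iff_reflTransGen _ _).2 hab
    exact hstep _ _ hb (ih hb) hbc

lemma exists_adj_of_mem_cluster {ω : Set (Sym2 (Fin d → ℤ))} {x y : Λ}
    (hy : y ∈ cluster G Λ ω x) (hne : y ≠ x) : ∃ z, (openGraph G Λ ω).Adj x z := by
  by_contra! hcon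
  refine hne (cluster_induction (P := fun y => y = x) rfl (fun u v _ hu huv => ?_) hy)
  subst hu
  exact absurd huv (hcon v)

/-- Removing an edge `xz` splits the cluster of `x` into the clusters of `x` and of `z`. -/
lemma mem_cluster_diff_edge {ω : Set (Sym2 (Fin d → ℤ))} {x y z : Λ}
    (hy : y ∈ cluster G Λ ω x) :
    y ∈ cluster G Λ (ω \ {s((x : Fin d → ℤ), (z : Fin d → ℤ))}) x ∨
      y ∈ cluster G Λ (ω \ {s((x : Fin d → ℤ), (z : Fin d → ℤ))}) z := by
  refine cluster_induction (P := fun y =>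
    y ∈ cluster G Λ (ω \ {s((x : Fin d → ℤ), (z : Fin d → ℤ))}) x ∨
      y ∈ cluster G Λ (ω \ {s((x : Fin d → ℤ), (z : Fin d → ℤ))}) z)
    (Or.inl (mem_cluster_self _ _)) (fun u v _ hu huv => ?_) hy
  rw [openGraph_adj] at huv
  by_cases he : s((u : Fin d → ℤ), (v : Fin d → ℤ)) = s((x : Fin d → ℤ), (z : Fin d → ℤ))
  · have hv : v = x ∨ v = z := by
      have : (v : Fin d → ℤ) ∈ s((x : Fin d → ℤ), (z : Fin d → ℤ)) := he ▸ Sym2.mem_mk_right _ _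
      simpa [Sym2.mem_iff, Subtype.ext_iff] using this
    rcases hv with rfl | rfl
    · exact Or.inl (mem_cluster_self _ _)
    · exact Or.inr (mem_cluster_self _ _)
  · have hadj : (openGraph G Λ (ω \ {s((x : Fin d → ℤ), (z : Fin d → ℤ))})).Adj u v :=
      openGraph_adj.2 ⟨huv.1, huv.2, he⟩
    exact hu.imp (mem_cluster_of_adj · hadj) (mem_cluster_of_adj · hadj)

/-- If `x` is connected to all points of `S` in a finite configuration, and `S` has at least two
points, then there are a branch point `v`, a partition `S = A ∪ B` into nonempty sets and disjoint
connections from `x` to `v`, from `v` to `A` and from `v` to `B`. -/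
theorem exists_branch [DecidableEq Λ] {ω : Set (Sym2 (Fin d → ℤ))} (hω : ω.Finite) {x : Λ}
    {S : Finset Λ} (hS : 2 ≤ S.card) (hSx : ↑S ⊆ cluster G Λ ω x) :
    ∃ (v : Λ) (A B : Finset Λ) (I J K : Set (Sym2 (Fin d → ℤ))),
      A.Nonempty ∧ B.Nonempty ∧ Disjoint A B ∧ A ∪ B = S ∧
      I ⊆ ω ∧ J ⊆ ω ∧ K ⊆ ω ∧ Disjoint I J ∧ Disjoint I K ∧ Disjoint J K ∧
      v ∈ cluster G Λ I x ∧ ↑A ⊆ cluster G Λ J v ∧ ↑B ⊆ cluster G Λ K v := by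
  classical
  induction hn : ω.ncard using Nat.strong_induction_on generalizing ω x with
  | _ n ih =>
  -- If `x ∈ S`, branch at `x` itself: `{x}` needs no edges, so all of `ω` is left for the other
  -- points.
  by_cases hxS : x ∈ S
  · refine ⟨x, {x}, S.erase x, ∅, ∅, ω, Finset.singleton_nonempty x, ?_, by simp, ?_, by simp,
      by simp, subset_rfl, by simp, by simp, by simp, mem_cluster_self _ _, ?_, ?_⟩
    · rw [← Finset.card_pos, Finset.card_erase_of_mem hxS]
      omega
    · rw [← Finset.insert_eq, Finset.insert_erase hxS]
    · simp [mem_cluster_self]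
    · exact fun y hy => hSx (Finset.mem_of_mem_erase hy)
  obtain ⟨s₀, hs₀⟩ : S.Nonempty := Finset.card_pos.1 (by omega)
  -- Otherwise delete an open edge `e = xz` and look at which points of `S` are still joined to `z`.
  obtain ⟨z, hxz⟩ := exists_adj_of_mem_cluster (hSx hs₀) (fun h => hxS (h ▸ hs₀))
  have he := openGraph_adj.1 hxz
  set e : Sym2 (Fin d → ℤ) := s((x : Fin d → ℤ), (z : Fin d → ℤ)) with he_def
  have hlt : (ω \ {e}).ncard < n := hn ▸ Set.ncard_sdiff_singleton_lt_of_mem he.2 hω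
  have hsub : ω \ {e} ⊆ ω := Set.sdiff_subset
  have hfin : (ω \ {e}).Finite := hω.subset hsub
  set D := cluster G Λ (ω \ {e}) z with hD
  have hsplit : ∀ y ∈ S, y ∉ D → y ∈ cluster G Λ (ω \ {e}) x :=
    fun y hy hyD => (mem_cluster_diff_edge (z := z) (hSx hy)).resolve_right hyD
  -- All of them: branch from `z` without `e`, then prepend `e` to the connection leading to `v`.
  by_cases h1 : ∀ y ∈ S, y ∈ D
  · obtain ⟨v, A, B, I, J, K, hA, hB, hAB, hU, hI, hJ, hK, hIJ, hIK, hJK, hv, hAv, hBv⟩ :=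
      ih _ hlt hfin (x := z) h1 rfl
    refine ⟨v, A, B, insert e I, J, K, hA, hB, hAB, hU,
      Set.insert_subset he.2 (hI.trans hsub), hJ.trans hsub, hK.trans hsub, ?_, ?_, hJK, ?_,
      hAv, hBv⟩
    · exact Set.disjoint_insert_left.2 ⟨fun h => (hJ h).2 rfl, hIJ⟩
    · exact Set.disjoint_insert_left.2 ⟨fun h => (hK h).2 rfl, hIK⟩
    · exact mem_cluster_trans (mem_cluster_of_adj (mem_cluster_self _ _)
        (openGraph_adj.2 ⟨he.1, Set.mem_insert _ _⟩)) (cluster_mono _ (Set.subset_insert _ _) hv)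
  -- None of them: `e` is not needed, and the smaller configuration still joins `x` to `S`.
  by_cases h2 : ∀ y ∈ S, y ∉ D
  · obtain ⟨v, A, B, I, J, K, hA, hB, hAB, hU, hI, hJ, hK, hrest⟩ :=
      ih _ hlt hfin (x := x) (fun y hy => hsplit y hy (h2 y hy)) rfl
    exact ⟨v, A, B, I, J, K, hA, hB, hAB, hU, hI.trans hsub, hJ.trans hsub, hK.trans hsub, hrest⟩
  push Not at h1 h2
  obtain ⟨b, hbS, hbD⟩ := h1
  obtain ⟨a, haS, haD⟩ := h2
  have hxD : x ∉ D := fun h => hbD (mem_cluster_trans h (hsplit b hbS hbD))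
  -- Mixed case: branch at `x`. The edges touching `D` include `e` and join `x` to all of `D`. By
  -- `hxD` the cluster of `x` without `e` avoids `D`, so the paths to the other points use no edge
  -- of `J`.
  set J : Set (Sym2 (Fin d → ℤ)) := {f ∈ ω | ∃ y ∈ D, (y : Fin d → ℤ) ∈ f} with hJ
  refine ⟨x, S.filter (· ∈ D), S.filter (· ∉ D), ∅, J, ω \ J, ⟨a, by simp [haS, haD]⟩,
    ⟨b, by simp [hbS, hbD]⟩, Finset.disjoint_filter_filter_not _ _ _,
    Finset.filter_union_filter_not_eq _ _, by simp, fun f hf => hf.1, Set.sdiff_subset, by simp,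
    by simp, Set.disjoint_sdiff_right, mem_cluster_self _ _, ?_, ?_⟩
  · intro y hy
    have hyD : y ∈ D := (Finset.mem_filter.1 hy).2
    refine cluster_induction (P := fun y => y ∈ cluster G Λ J x) ?_ (fun u v hu hu' huv => ?_) hyD
    · exact mem_cluster_of_adj (mem_cluster_self _ _)
        (openGraph_adj.2 ⟨he.1, he.2, z, mem_cluster_self _ _, Sym2.mem_mk_right _ _⟩)
    · rw [openGraph_adj] at huv
      exact mem_cluster_of_adj hu'
        (openGraph_adj.2 ⟨huv.1, huv.2.1, u, hu, Sym2.mem_mk_left _ _⟩)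
  · intro y hy
    obtain ⟨hyS, hyD⟩ := Finset.mem_filter.1 hy
    have hout : ∀ u ∈ cluster G Λ (ω \ {e}) x, u ∉ D := fun u hu huD =>
      hxD (SimpleGraph.Reachable.trans huD (SimpleGraph.Reachable.symm hu))
    refine cluster_induction (P := fun y => y ∈ cluster G Λ (ω \ J) x) (mem_cluster_self _ _)
      (fun u v hu hu' huv => ?_) (hsplit y hyS hyD)
    have hv := hout v (mem_cluster_of_adj hu huv)
    rw [openGraph_adj] at huv
    refine mem_cluster_of_adj hu' (openGraph_adj.2 ⟨huv.1, huv.2.1, ?_⟩)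
    rintro ⟨-, t, htD, ht⟩
    rcases Sym2.mem_iff.1 ht with h | h
    · exact hout u hu (Subtype.ext h ▸ htD)
    · exact hv (Subtype.ext h ▸ htD)

end Branch

/-! ### The tree-graph inequality and the quadratic recursion. -/

open Classical in
/-- The indicator, with values in `[0, ∞]`, that all of `S` lies in the cluster of `x`. -/
noncomputable def connInd {d : ℕ} (G : SimpleGraph (Fin d → ℤ)) (Λ : Set (Fin d → ℤ))
    (S : Finset Λ) (x : Λ) (ω : Set (Sym2 (Fin d → ℤ))) : ℝ≥0∞ :=
  if ↑S ⊆ cluster G Λ ω x then 1 else 0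

/-- The weight of the connection of `x` to all of `S` when only the edges in `l` can be open. -/
noncomputable def connWeight {d : ℕ} (G : SimpleGraph (Fin d → ℤ)) (Λ : Set (Fin d → ℤ))
    (w w' : Sym2 (Fin d → ℤ) → ℝ≥0∞) (l : List (Sym2 (Fin d → ℤ))) (S : Finset Λ) (x : Λ) : ℝ≥0∞ :=
  listExp w w' l (connInd G Λ S x)

section TreeGraph

variable {d : ℕ} {G : SimpleGraph (Fin d → ℤ)} {Λ : Set (Fin d → ℤ)}
  {w w' : Sym2 (Fin d → ℤ) → ℝ≥0∞}

lemma connInd_of_subset {S : Finset Λ} {x : Λ} {ω : Set (Sym2 (Fin d → ℤ))}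
    (h : ↑S ⊆ cluster G Λ ω x) : connInd G Λ S x ω = 1 := if_pos h

lemma connInd_mono (S : Finset Λ) (x : Λ) : Monotone (connInd G Λ S x) := by
  intro ω ω' h
  unfold connInd
  split_ifs with h1 h2 <;> first | exact le_rfl | exact zero_le | skip
  exact absurd (h1.trans (cluster_mono x h)) h2

open Classical in
/-- The ways to split `S` into two nonempty sets `A` and `B`. -/
noncomputable def splitInd {α : Type*} (S A B : Finset α) : ℝ≥0∞ :=
  if A.Nonempty ∧ B.Nonempty ∧ Disjoint A B ∧ A ∪ B = S then 1 else 0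

/-- The nested `disjointSup` encodes the three disjoint edge sets of `exists_branch`, in a form to
which the product inequality can be applied twice. -/
lemma connInd_le_tsum {ω : Set (Sym2 (Fin d → ℤ))} (hω : ω.Finite) {S : Finset Λ}
    (hS : 2 ≤ S.card) (x : Λ) :
    connInd G Λ S x ω ≤ ∑' (v : Λ) (A : Finset Λ) (B : Finset Λ), splitInd S A B *
      disjointSup (fun I J => connInd G Λ {v} x I *
        disjointSup (fun I J => connInd G Λ A v I * connInd G Λ B v J) J) ω := by
  classical
  by_cases hSx : ↑S ⊆ cluster G Λ ω x
  swap
  · simp [connInd, hSx]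
  obtain ⟨v, A, B, I, J, K, hA, hB, hAB, hU, hI, hJ, hK, hIJ, hIK, hJK, hv, hAv, hBv⟩ :=
    exists_branch hω hS hSx
  refine le_trans ?_ (ENNReal.le_tsum v)
  refine le_trans ?_ (ENNReal.le_tsum A)
  refine le_trans ?_ (ENNReal.le_tsum B)
  have hsplit : splitInd S A B = 1 := by
    rw [splitInd, if_pos]
    exact ⟨hA, hB, hAB, by convert hU⟩
  rw [hsplit, one_mul, connInd_of_subset hSx]
  refine le_trans ?_ (le_iSup₂ (f := fun (I : Set _) (_ : I ⊆ ω) => connInd G Λ {v} x I *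
        disjointSup (fun I J => connInd G Λ A v I * connInd G Λ B v J) (ω \ I)) I hI)
  rw [connInd_of_subset (by simpa using hv), one_mul]
  refine le_trans ?_ (le_iSup₂ (f := fun (J : Set _) (_ : J ⊆ ω \ I) =>
    connInd G Λ A v J * connInd G Λ B v ((ω \ I) \ J)) J
      (Set.subset_sdiff.2 ⟨hJ, hIJ.symm⟩))
  rw [connInd_of_subset hAv, connInd_of_subset (hBv.trans (cluster_mono v ?_)), one_mul]
  exact Set.subset_sdiff.2 ⟨Set.subset_sdiff.2 ⟨hK, hIK.symm⟩, hJK.symm⟩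

/-- The tree-graph inequality: the connection of `x` to `S` branches at some point `v`. -/
theorem connWeight_le_tsum (hw : ∀ e, w e + w' e = 1) (l : List (Sym2 (Fin d → ℤ)))
    {S : Finset Λ} (hS : 2 ≤ S.card) (x : Λ) :
    connWeight G Λ w w' l S x ≤ ∑' (v : Λ) (A : Finset Λ) (B : Finset Λ), splitInd S A B *
      (connWeight G Λ w w' l {v} x *
        (connWeight G Λ w w' l A v * connWeight G Λ w w' l B v)) := by
  refine (listExp_mono l fun ω hω => connInd_le_tsum hω hS x).trans ?_
  simp only [listExp_tsum, listExp_const_mul]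
  refine ENNReal.tsum_le_tsum fun v => ENNReal.tsum_le_tsum fun A =>
    ENNReal.tsum_le_tsum fun B => ?_
  gcongr
  refine (listExp_disjointSup_mul_le hw l (connInd_mono _ _) (disjointSup_mono fun I => ?_)).trans
    (mul_le_mul_right (listExp_disjointSup_mul_le hw l (connInd_mono _ _) (connInd_mono _ _)) _)
  exact fun J J' h => mul_le_mul_right (connInd_mono _ _ h) _

open Classical in
/-- The weight `∏_{y ∈ S} ψ(y)` if `1 ≤ |S| ≤ n`, and `0` otherwise. -/
noncomputable def prodWeight {α : Type*} (ψ : α → ℝ≥0∞) (n : ℕ) (S : Finset α) : ℝ≥0∞ :=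
  if S.Nonempty ∧ S.card ≤ n then ∏ y ∈ S, ψ y else 0

/-- Only `S = A ∪ B` contributes. As `A` and `B` are nonempty and disjoint, `|S| ≤ n + 1` forces
both to have at most `n` points, which is what lets the truncation level drop. -/
lemma tsum_prodWeight_mul_splitInd_le {α : Type*} (ψ : α → ℝ≥0∞) (n : ℕ) (A B : Finset α) :
    ∑' S, prodWeight ψ (n + 1) S * splitInd S A B ≤ prodWeight ψ n A * prodWeight ψ n B := by
  classical
  rw [tsum_eq_single (A ∪ B)]
  · unfold prodWeight splitInd
    by_cases h : A.Nonempty ∧ B.Nonempty ∧ Disjoint A B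
    · obtain ⟨hA, hB, hAB⟩ := h
      have hcA := hA.card_pos
      have hcB := hB.card_pos
      have hc := Finset.card_union_of_disjoint hAB
      by_cases hn : (A ∪ B).card ≤ n + 1
      · rw [if_pos ⟨hA.mono Finset.subset_union_left, hn⟩, if_pos ⟨hA, hB, hAB, by congr!⟩,
          if_pos ⟨hA, by omega⟩, if_pos ⟨hB, by omega⟩, Finset.prod_union hAB, mul_one]
      · simp [hn]
    · rw [if_neg (c := _ ∧ _ ∧ _ ∧ _) fun h' => h ⟨h'.1, h'.2.1, h'.2.2.1⟩, mul_zero]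
      exact zero_le
  · intro S hS
    rw [splitInd, if_neg, mul_zero]
    rintro ⟨-, -, -, h⟩
    exact hS (by rw [← h])

/-- The truncated generating function of the connection weights from `x`. -/
noncomputable def connGen (G : SimpleGraph (Fin d → ℤ)) (Λ : Set (Fin d → ℤ))
    (w w' : Sym2 (Fin d → ℤ) → ℝ≥0∞) (l : List (Sym2 (Fin d → ℤ))) (ψ : Λ → ℝ≥0∞) (n : ℕ)
    (x : Λ) : ℝ≥0∞ :=
  ∑' S : Finset Λ, prodWeight ψ n S * connWeight G Λ w w' l S x

lemma connGen_zero (l : List (Sym2 (Fin d → ℤ))) (ψ : Λ → ℝ≥0∞) (x : Λ) :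
    connGen G Λ w w' l ψ 0 x = 0 := by
  refine ENNReal.tsum_eq_zero.2 fun S => ?_
  rw [prodWeight, if_neg, zero_mul]
  rintro ⟨h, h'⟩
  have := h.card_pos
  omega

/-- Singletons give the linear term; larger sets branch at `v`, and the free sum over `A` and `B`
factorises into a square. -/
lemma connGen_succ_le (hw : ∀ e, w e + w' e = 1) (l : List (Sym2 (Fin d → ℤ))) (ψ : Λ → ℝ≥0∞)
    (n : ℕ) (x : Λ) :
    connGen G Λ w w' l ψ (n + 1) x ≤ ∑' y, ψ y * connWeight G Λ w w' l {y} x +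
      ∑' v, connWeight G Λ w w' l {v} x * connGen G Λ w w' l ψ n v ^ 2 := by
  classical
  set T := connWeight G Λ w w' l with hT
  have hterm : ∀ S : Finset Λ, prodWeight ψ (n + 1) S * T S x ≤
      (∑' y, if S = {y} then ψ y * T {y} x else 0) +
        prodWeight ψ (n + 1) S * ∑' (v : Λ) (A : Finset Λ) (B : Finset Λ),
          splitInd S A B * (T {v} x * (T A v * T B v)) := by
    intro S
    by_cases h2 : 2 ≤ S.card
    · exact le_add_left (mul_le_mul_right (connWeight_le_tsum hw l h2 x) _)
    by_cases h0 : S.card = 0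
    · rw [Finset.card_eq_zero] at h0
      simp [prodWeight, h0]
    · obtain ⟨y, rfl⟩ := Finset.card_eq_one.1 (by omega : S.card = 1)
      refine le_add_right (le_trans ?_ (ENNReal.le_tsum y))
      simp [prodWeight]
  refine (ENNReal.tsum_le_tsum hterm).trans ?_
  rw [ENNReal.tsum_add]
  gcongr ?_ + ?_
  · rw [ENNReal.tsum_comm]
    simp
  · simp only [← ENNReal.tsum_mul_left]
    rw [ENNReal.tsum_comm]
    refine ENNReal.tsum_le_tsum fun v => ?_
    calc ∑' S, ∑' A, ∑' B, prodWeight ψ (n + 1) S * (splitInd S A B * (T {v} x * (T A v * T B v)))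
        = ∑' A, ∑' B, (∑' S, prodWeight ψ (n + 1) S * splitInd S A B) *
            (T {v} x * (T A v * T B v)) := by
          rw [ENNReal.tsum_comm]
          refine tsum_congr fun A => ?_
          rw [ENNReal.tsum_comm]
          refine tsum_congr fun B => ?_
          rw [← ENNReal.tsum_mul_right]
          exact tsum_congr fun S => (mul_assoc _ _ _).symm
      _ ≤ ∑' A, ∑' B, (prodWeight ψ n A * prodWeight ψ n B) * (T {v} x * (T A v * T B v)) := by
          gcongr
          exact tsum_prodWeight_mul_splitInd_le _ _ _ _
      _ = T {v} x * connGen G Λ w w' l ψ n v ^ 2 := by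
          rw [sq, connGen, ← ENNReal.tsum_mul_right, ← ENNReal.tsum_mul_left]
          refine tsum_congr fun A => ?_
          rw [← ENNReal.tsum_mul_left, ← ENNReal.tsum_mul_left]
          exact tsum_congr fun B => by ring

/-- If the two-point weights are bounded by `h` and `∑_y h(x, y) (h * φ (y))² ≤ C (h * φ)(x)`, then
the generating function at `ψ = ε φ` is at most `2 ε (h * φ)` as long as `4 ε C ≤ 1`. -/
theorem connGen_le (hw : ∀ e, w e + w' e = 1) (l : List (Sym2 (Fin d → ℤ)))
    {φ : Λ → ℝ≥0} {h : Λ → Λ → ℝ≥0} {C ε : ℝ≥0} (hε : 4 * ε * C ≤ 1)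
    (hτ : ∀ x y, connWeight G Λ w w' l {y} x ≤ h x y)
    (hC : ∀ x : Λ, ∑' y : Λ, (h x y : ℝ≥0∞) * (conv h φ y) ^ 2 ≤ (C : ℝ≥0∞) * conv h φ x)
    (n : ℕ) (x : Λ) :
    connGen G Λ w w' l (fun y => (ε : ℝ≥0∞) * φ y) n x ≤ 2 * ε * conv h φ x := by
  induction n generalizing x with
  | zero => rw [connGen_zero]; exact zero_le
  | succ n ih =>
    refine (connGen_succ_le hw l _ n x).trans ?_
    -- Squaring `2ε h*φ` costs `4ε²`, and `4εC ≤ 1` makes the quadratic term at most a second copy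
    -- of `ε h*φ`.
    calc ∑' y, ((ε : ℝ≥0∞) * φ y) * connWeight G Λ w w' l {y} x +
          ∑' v, connWeight G Λ w w' l {v} x *
            connGen G Λ w w' l (fun y => (ε : ℝ≥0∞) * φ y) n v ^ 2
        ≤ ∑' y, ((ε : ℝ≥0∞) * φ y) * h x y + ∑' v, (h x v : ℝ≥0∞) * (2 * ε * conv h φ v) ^ 2 := by
          gcongr
          · exact hτ _ _
          · exact hτ _ _
          · exact ih _
      _ = ε * conv h φ x + 4 * ε ^ 2 * ∑' v, (h x v : ℝ≥0∞) * (conv h φ v) ^ 2 := by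
          rw [conv, ← ENNReal.tsum_mul_left, ← ENNReal.tsum_mul_left]
          congr 1
          · exact tsum_congr fun y => by ring
          · exact tsum_congr fun y => by ring
      _ ≤ ε * conv h φ x + 4 * ε ^ 2 * (C * conv h φ x) := by
          gcongr
          exact hC x
      _ = ε * conv h φ x + ((4 * ε * C : ℝ≥0) : ℝ≥0∞) * (ε * conv h φ x) := by
          push_cast
          ring
      _ ≤ ε * conv h φ x + 1 * (ε * conv h φ x) := by
          gcongr
          exact_mod_cast hε
      _ = 2 * ε * conv h φ x := by ring

end TreeGraph

/-! ### Finite marginals of the percolation measure. -/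

section Law

variable {ι : Type*}

/-- The law of the state of the element `e` under `setBernoulli u p`. -/
noncomputable def siteLaw (u : Set ι) (p : unitInterval) (e : ι) : Measure Prop :=
  unitInterval.toNNReal p • Measure.dirac (e ∈ u) +
    unitInterval.toNNReal (unitInterval.symm p) • Measure.dirac False

instance (u : Set ι) (p : unitInterval) (e : ι) : IsProbabilityMeasure (siteLaw u p e) := by
  unfold siteLaw
  infer_instance

lemma siteLaw_true_add_false (u : Set ι) (p : unitInterval) (e : ι) :
    siteLaw u p e {True} + siteLaw u p e {False} = 1 := by
  rw [← measure_union (by simp) (MeasurableSet.singleton _), ← measure_univ (μ := siteLaw u p e)]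
  congr 1
  ext q
  by_cases hq : q <;> simp [hq]

lemma setBernoulli_cylinder [DecidableEq ι] (u : Set ι) (p : unitInterval) {A B : Finset ι}
    (hAB : Disjoint A B) :
    setBernoulli u p {s | (∀ e ∈ A, e ∈ s) ∧ ∀ e ∈ B, e ∉ s} =
      (∏ e ∈ A, siteLaw u p e {True}) * ∏ e ∈ B, siteLaw u p e {False} := by
  have hdis : ∀ e ∈ B, e ∉ A := fun e hB hA => Finset.disjoint_left.1 hAB hA hB
  have hset : (fun q : ι → Prop => {i | q i}) ⁻¹' {s | (∀ e ∈ A, e ∈ s) ∧ ∀ e ∈ B, e ∉ s} =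
      Set.pi ↑(A ∪ B) (fun e => if e ∈ A then {True} else {False}) := by
    ext q
    simp only [Set.mem_preimage, Set.mem_ofPred_eq, Set.mem_pi, Finset.coe_union, Set.mem_union,
      Finset.mem_coe]
    constructor
    · rintro ⟨h1, h2⟩ e (he | he)
      · simpa [he] using h1 e he
      · simpa [hdis e he] using h2 e he
    · intro h
      refine ⟨fun e he => ?_, fun e he => ?_⟩
      · simpa [he] using h e (Or.inl he)
      · simpa [hdis e he] using h e (Or.inr he)
  rw [setBernoulli_apply', hset]
  change Measure.infinitePi (siteLaw u p) _ = _
  rw [Measure.infinitePi_pi _ (fun e _ => by split_ifs <;> exact MeasurableSet.singleton _),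
    Finset.prod_union hAB]
  congr 1
  · exact Finset.prod_congr rfl fun e he => by rw [if_pos he]
  · exact Finset.prod_congr rfl fun e he => by rw [if_neg (hdis e he)]

-- `A` and `B` record the elements already revealed as present and absent, so that the induction on
-- `l` can condition on one element at a time.
open Classical in
lemma setBernoulli_cylinder_inter_list (u : Set ι) (p : unitInterval) (l : List ι) (hl : l.Nodup)
    {A B : Finset ι} (hAB : Disjoint A B) (hA : ∀ e ∈ l, e ∉ A) (hB : ∀ e ∈ l, e ∉ B)
    (Q : Set ι → Prop) :
    setBernoulli u p {s | ((∀ e ∈ A, e ∈ s) ∧ ∀ e ∈ B, e ∉ s) ∧ Q {e | e ∈ s ∧ e ∈ l}} =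
      ((∏ e ∈ A, siteLaw u p e {True}) * ∏ e ∈ B, siteLaw u p e {False}) *
        listExp (fun e => siteLaw u p e {True}) (fun e => siteLaw u p e {False}) l
          (fun ω => if Q ω then 1 else 0) := by
  induction l generalizing A B Q with
  | nil =>
    have h0 : ∀ s : Set ι, {e | e ∈ s ∧ e ∈ ([] : List ι)} = ∅ := fun s => by simp
    simp only [h0, listExp]
    by_cases hQ : Q ∅
    · simp only [hQ, and_true, if_true, mul_one]
      exact setBernoulli_cylinder u p hAB
    · simp [hQ]
  | cons a l ih =>
    rw [List.nodup_cons] at hl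
    have haA := hA a List.mem_cons_self
    have haB := hB a List.mem_cons_self
    rw [← measure_inter_add_sdiff _ (measurableSet_mem a)]
    have h1 : {s : Set ι | ((∀ e ∈ A, e ∈ s) ∧ ∀ e ∈ B, e ∉ s) ∧ Q {e | e ∈ s ∧ e ∈ a :: l}} ∩
        {s | a ∈ s} = {s | ((∀ e ∈ insert a A, e ∈ s) ∧ ∀ e ∈ B, e ∉ s) ∧
          Q (insert a {e | e ∈ s ∧ e ∈ l})} := by
      ext s
      simp only [Set.mem_inter_iff, Set.mem_ofPred_eq, Finset.forall_mem_insert]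
      have : a ∈ s → {e | e ∈ s ∧ e ∈ a :: l} = insert a {e | e ∈ s ∧ e ∈ l} := by
        intro ha
        ext e
        simp only [Set.mem_ofPred_eq, List.mem_cons, Set.mem_insert_iff]
        grind
      constructor
      · rintro ⟨⟨⟨hs1, hs2⟩, hs3⟩, ha⟩
        exact ⟨⟨⟨ha, hs1⟩, hs2⟩, this ha ▸ hs3⟩
      · rintro ⟨⟨⟨ha, hs1⟩, hs2⟩, hs3⟩
        exact ⟨⟨⟨hs1, hs2⟩, (this ha).symm ▸ hs3⟩, ha⟩
    have h2 : {s : Set ι | ((∀ e ∈ A, e ∈ s) ∧ ∀ e ∈ B, e ∉ s) ∧ Q {e | e ∈ s ∧ e ∈ a :: l}} \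
        {s | a ∈ s} = {s | ((∀ e ∈ A, e ∈ s) ∧ ∀ e ∈ insert a B, e ∉ s) ∧
          Q {e | e ∈ s ∧ e ∈ l}} := by
      ext s
      simp only [Set.mem_sdiff, Set.mem_ofPred_eq, Finset.forall_mem_insert]
      have : a ∉ s → {e | e ∈ s ∧ e ∈ a :: l} = {e | e ∈ s ∧ e ∈ l} := by
        intro ha
        ext e
        simp only [Set.mem_ofPred_eq, List.mem_cons]
        grind
      constructor
      · rintro ⟨⟨⟨hs1, hs2⟩, hs3⟩, ha⟩
        exact ⟨⟨hs1, ha, hs2⟩, this ha ▸ hs3⟩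
      · rintro ⟨⟨hs1, ha, hs2⟩, hs3⟩
        exact ⟨⟨⟨hs1, hs2⟩, (this ha).symm ▸ hs3⟩, ha⟩
    rw [h1, h2, ih hl.2 (A := insert a A) (B := B) (Q := fun ω => Q (insert a ω)),
      ih hl.2 (A := A) (B := insert a B) (Q := Q), Finset.prod_insert haA, Finset.prod_insert haB,
      listExp]
    · ring
    · exact Finset.disjoint_insert_right.2 ⟨haA, hAB⟩
    · exact fun e he => hA e (List.mem_cons_of_mem _ he)
    · intro e he
      rw [Finset.mem_insert, not_or]
      exact ⟨fun h => hl.1 (h ▸ he), hB e (List.mem_cons_of_mem _ he)⟩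
    · exact Finset.disjoint_insert_left.2 ⟨haB, hAB⟩
    · intro e he
      rw [Finset.mem_insert, not_or]
      exact ⟨fun h => hl.1 (h ▸ he), hA e (List.mem_cons_of_mem _ he)⟩
    · exact fun e he => hB e (List.mem_cons_of_mem _ he)

open Classical in
/-- Under `setBernoulli`, the trace of the random set on a finite set has the law of `listExp`. -/
lemma setBernoulli_inter_finset (u : Set ι) (p : unitInterval) (F : Finset ι)
    (Q : Set ι → Prop) :
    setBernoulli u p {s | Q (s ∩ F)} =
      listExp (fun e => siteLaw u p e {True}) (fun e => siteLaw u p e {False}) F.toList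
        (fun ω => if Q ω then 1 else 0) := by
  have h := setBernoulli_cylinder_inter_list u p F.toList F.nodup_toList
    (Finset.disjoint_empty_left ∅) (by simp) (by simp) Q
  simpa [Set.inter_def] using h

lemma measurableSet_inter_finset (F : Finset ι) (Q : Set ι → Prop) :
    MeasurableSet {s : Set ι | Q (s ∩ F)} := by
  classical
  have : {s : Set ι | Q (s ∩ F)} = ⋃ A ∈ F.powerset.filter (fun A : Finset ι => Q ↑A),
      ⋂ e ∈ F, {s : Set ι | e ∈ s ↔ e ∈ A} := by
    ext s
    simp only [Set.mem_ofPred_eq, Set.mem_iUnion, Set.mem_iInter, Finset.mem_filter,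
      Finset.mem_powerset, exists_prop]
    constructor
    · intro hs
      refine ⟨F.filter (· ∈ s), ⟨Finset.filter_subset _ _, ?_⟩, fun e he => by simp [he]⟩
      convert hs using 1
      ext e
      simp [and_comm]
    · rintro ⟨A, ⟨hAF, hQ⟩, hA⟩
      convert hQ using 1
      ext e
      simp only [Set.mem_inter_iff, Finset.mem_coe]
      exact ⟨fun h => (hA e h.2).1 h.1, fun h => ⟨(hA e (hAF h)).2 h, hAF h⟩⟩
  rw [this]
  refine Finset.measurableSet_biUnion _ fun A _ => Finset.measurableSet_biInter _ fun e _ => ?_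
  by_cases he : e ∈ A
  · simpa [he] using measurableSet_mem e
  · simpa [he] using measurableSet_notMem e

end Law

/-! ### From finitely many edges to the full graph. -/

section Exhaustion

variable {d : ℕ} {G : SimpleGraph (Fin d → ℤ)} {Λ : Set (Fin d → ℤ)}

/-- The first `n` edges in an enumeration of all pairs of points of `ℤ^d`. -/
noncomputable def edgeExhaustion (d n : ℕ) : Finset (Sym2 (Fin d → ℤ)) :=
  letI := Encodable.ofCountable (Sym2 (Fin d → ℤ))
  (Finset.range n).preimage Encodable.encode Encodable.encode_injective.injOn

lemma mem_edgeExhaustion {d n : ℕ} {e : Sym2 (Fin d → ℤ)} :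
    letI := Encodable.ofCountable (Sym2 (Fin d → ℤ))
    e ∈ edgeExhaustion d n ↔ Encodable.encode e < n := by
  simp [edgeExhaustion]

lemma edgeExhaustion_mono (d : ℕ) : Monotone (edgeExhaustion d) := fun _ _ h _ he =>
  mem_edgeExhaustion.2 ((mem_edgeExhaustion.1 he).trans_le h)

lemma exists_mem_edgeExhaustion {d : ℕ} (e : Sym2 (Fin d → ℤ)) : ∃ n, e ∈ edgeExhaustion d n :=
  ⟨_, mem_edgeExhaustion.2 (Nat.lt_succ_self _)⟩

lemma inter_edgeExhaustion_mono (ω : Set (Sym2 (Fin d → ℤ))) :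
    Monotone fun n => ω ∩ (edgeExhaustion d n : Set (Sym2 (Fin d → ℤ))) := fun _ _ h =>
  Set.inter_subset_inter_right _ (Finset.coe_subset.2 (edgeExhaustion_mono d h))

/-- A connecting path uses finitely many edges. -/
lemma exists_mem_cluster_inter_edgeExhaustion {ω : Set (Sym2 (Fin d → ℤ))} {x y : Λ}
    (hy : y ∈ cluster G Λ ω x) : ∃ n, y ∈ cluster G Λ (ω ∩ edgeExhaustion d n) x := by
  refine cluster_induction (P := fun y => ∃ n, y ∈ cluster G Λ (ω ∩ edgeExhaustion d n) x)
    ⟨0, mem_cluster_self _ _⟩ ?_ hy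
  rintro u v - ⟨n, hn⟩ huv
  rw [openGraph_adj] at huv
  obtain ⟨m, hm⟩ := exists_mem_edgeExhaustion s((u : Fin d → ℤ), (v : Fin d → ℤ))
  refine ⟨max n m, mem_cluster_of_adj
    (cluster_mono x (inter_edgeExhaustion_mono ω (le_max_left n m)) hn)
    (openGraph_adj.2 ⟨huv.1, huv.2, edgeExhaustion_mono d (le_max_right n m) hm⟩)⟩

lemma exists_subset_cluster_inter_edgeExhaustion {ω : Set (Sym2 (Fin d → ℤ))} {x : Λ}
    {S : Finset Λ} (hS : ↑S ⊆ cluster G Λ ω x) :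
    ∃ n, ↑S ⊆ cluster G Λ (ω ∩ edgeExhaustion d n) x := by
  choose! n hn using fun (y : Λ) (hy : y ∈ S) =>
    exists_mem_cluster_inter_edgeExhaustion (hS (Finset.mem_coe.2 hy))
  exact ⟨S.sup n, fun y hy =>
    cluster_mono x (inter_edgeExhaustion_mono ω (Finset.le_sup hy)) (hn y hy)⟩

lemma setOf_subset_cluster_eq_iUnion (S : Finset Λ) (x : Λ) :
    {ω | ↑S ⊆ cluster G Λ ω x} = ⋃ n, {ω | ↑S ⊆ cluster G Λ (ω ∩ edgeExhaustion d n) x} := by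
  ext ω
  simp only [Set.mem_iUnion, Set.mem_ofPred_eq]
  exact ⟨exists_subset_cluster_inter_edgeExhaustion,
    fun ⟨n, hn⟩ => hn.trans (cluster_mono x Set.inter_subset_left)⟩

lemma measurableSet_subset_cluster (S : Finset Λ) (x : Λ) :
    MeasurableSet {ω | ↑S ⊆ cluster G Λ ω x} := by
  rw [setOf_subset_cluster_eq_iUnion]
  exact MeasurableSet.iUnion fun n =>
    measurableSet_inter_finset _ (fun ω => ↑S ⊆ cluster G Λ ω x)

/-- The probability that `x` is connected to all of `S` by the first `n` edges. -/
lemma bondMeasure_inter_edgeExhaustion (p : unitInterval) (S : Finset Λ) (x : Λ) (n : ℕ) :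
    bondMeasure G p {ω | ↑S ⊆ cluster G Λ (ω ∩ edgeExhaustion d n) x} =
      connWeight G Λ (fun e => siteLaw G.edgeSet p e {True})
        (fun e => siteLaw G.edgeSet p e {False}) (edgeExhaustion d n).toList S x := by
  exact setBernoulli_inter_finset G.edgeSet p (edgeExhaustion d n)
    (fun ω => ↑S ⊆ cluster G Λ ω x)

lemma tendsto_bondMeasure_inter_edgeExhaustion (p : unitInterval) (S : Finset Λ) (x : Λ) :
    Filter.Tendsto
      (fun n => bondMeasure G p {ω | ↑S ⊆ cluster G Λ (ω ∩ edgeExhaustion d n) x})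
      Filter.atTop (nhds (bondMeasure G p {ω | ↑S ⊆ cluster G Λ ω x})) := by
  rw [setOf_subset_cluster_eq_iUnion]
  exact tendsto_measure_iUnion_atTop fun n m h ω hω =>
    Set.Subset.trans hω (cluster_mono x (inter_edgeExhaustion_mono ω h))

/-- The sum over nonempty finite sets `S` of `ε^|S| ∏_{y ∈ S} φ(y)` times the probability that `x`
is connected to all of `S` is at most `2 ε (h * φ)(x)`. -/
theorem tsum_prod_mul_bondMeasure_le (p : unitInterval) {φ : Λ → ℝ≥0} {h : Λ → Λ → ℝ≥0}
    {C ε : ℝ≥0} (hε : 4 * ε * C ≤ 1)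
    (hτ : ∀ x y : Λ, tau G p Λ x y ≤ (h x y : ℝ≥0∞))
    (hC : ∀ x : Λ, ∑' y : Λ, (h x y : ℝ≥0∞) * (conv h φ y) ^ 2 ≤ (C : ℝ≥0∞) * conv h φ x)
    (x : Λ) :
    ∑' S : {S : Finset Λ // S.Nonempty}, (∏ y ∈ S.1, (ε : ℝ≥0∞) * φ y) *
      bondMeasure G p {ω | ↑S.1 ⊆ cluster G Λ ω x} ≤ 2 * ε * conv h φ x := by
  -- Over a finite family of sets `S` the limit in the number of edges passes through the sum, and
  -- the cardinalities have a common bound `N`, so truncation at `N` loses nothing.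
  rw [ENNReal.tsum_eq_iSup_sum]
  refine iSup_le fun 𝒮 => ?_
  refine le_of_tendsto (tendsto_finsetSum 𝒮 fun S _ => ENNReal.Tendsto.const_mul
    (tendsto_bondMeasure_inter_edgeExhaustion p S.1 x) (Or.inr ?_))
    (Filter.Eventually.of_forall fun n => ?_)
  · exact ENNReal.prod_ne_top fun y _ => ENNReal.mul_ne_top ENNReal.coe_ne_top ENNReal.coe_ne_top
  set N := 𝒮.sup fun S => S.1.card
  simp only [bondMeasure_inter_edgeExhaustion]
  set T := connWeight G Λ (fun e => siteLaw G.edgeSet p e {True})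
    (fun e => siteLaw G.edgeSet p e {False}) (edgeExhaustion d n).toList with hT
  calc ∑ S ∈ 𝒮, (∏ y ∈ S.1, (ε : ℝ≥0∞) * φ y) * T S.1 x
      = ∑ S ∈ 𝒮, prodWeight (fun y => (ε : ℝ≥0∞) * φ y) N S.1 * T S.1 x := by
        refine Finset.sum_congr rfl fun S hS => ?_
        rw [prodWeight, if_pos ⟨S.2, Finset.le_sup (f := fun S => S.1.card) hS⟩]
    _ ≤ ∑' S : {S : Finset Λ // S.Nonempty},
          prodWeight (fun y => (ε : ℝ≥0∞) * φ y) N S.1 * T S.1 x := ENNReal.sum_le_tsum 𝒮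
    _ ≤ ∑' S : Finset Λ, prodWeight (fun y => (ε : ℝ≥0∞) * φ y) N S * T S x :=
        ENNReal.tsum_comp_le_tsum_of_injective Subtype.val_injective
          (fun S : Finset Λ => prodWeight (fun y => (ε : ℝ≥0∞) * φ y) N S * T S x)
    _ ≤ 2 * ε * conv h φ x := by
        refine connGen_le (siteLaw_true_add_false _ _) _ hε (fun x y => ?_) hC N x
        rw [← bondMeasure_inter_edgeExhaustion]
        refine le_trans (measure_mono fun ω hω => ?_) (hτ x y)
        exact cluster_mono x Set.inter_subset_left
          (hω (Finset.mem_coe.2 (Finset.mem_singleton_self y)))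

end Exhaustion

/-! ### Expansion of the exponential over finite subsets of the cluster. -/

section Exponential

variable {α : Type*}

lemma exp_coe_nnreal_le {a : ℝ≥0} (ha : a ≤ 1) :
    EReal.exp (((a : ℝ≥0∞) : EReal)) ≤ 1 + 2 * (a : ℝ≥0∞) := by
  have ha' : (a : ℝ) ≤ 1 := ha
  have h := (abs_le.1 (Real.abs_exp_sub_one_le (x := a) (by rwa [abs_of_nonneg a.coe_nonneg]))).2
  rw [abs_of_nonneg a.coe_nonneg] at h
  have hcast : (((a : ℝ≥0∞) : EReal)) = ((a : ℝ) : EReal) := rfl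
  rw [hcast, EReal.exp_coe, ENNReal.ofReal_le_iff_le_toReal (by finiteness)]
  have : (1 + 2 * (a : ℝ≥0∞)).toReal = 1 + 2 * (a : ℝ) := by
    rw [ENNReal.toReal_add (by finiteness) (by finiteness)]
    simp
  rw [this]
  linarith

lemma exp_sum_le (a : α → ℝ≥0) (ha : ∀ y, a y ≤ 1) (F : Finset α) :
    EReal.exp ((∑ y ∈ F, (a y : ℝ≥0∞) : ℝ≥0∞) : EReal) ≤ ∏ y ∈ F, (1 + 2 * (a y : ℝ≥0∞)) := by
  classical
  induction F using Finset.induction_on with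
  | empty => simp
  | insert y F hy ih =>
    rw [Finset.sum_insert hy, Finset.prod_insert hy, EReal.coe_ennreal_add, EReal.exp_add]
    exact mul_le_mul' (exp_coe_nnreal_le (ha y)) ih

lemma prod_one_add_le_tsum (b : α → ℝ≥0∞) (F : Finset α) :
    ∏ y ∈ F, (1 + b y) ≤ 1 + ∑' S : {S : Finset α // S.Nonempty}, ∏ y ∈ S.1, b y := by
  classical
  rw [Finset.prod_one_add, ← Finset.add_sum_erase _ _ (Finset.empty_mem_powerset F),
    Finset.prod_empty]
  gcongr
  have hne : ∀ S ∈ F.powerset.erase ∅, S.Nonempty := fun S hS =>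
    Finset.nonempty_iff_ne_empty.2 (Finset.ne_of_mem_erase hS)
  rw [← Finset.sum_subtype_of_mem (fun S : Finset α => ∏ y ∈ S, b y) hne]
  exact ENNReal.sum_le_tsum _

/-- Taking logarithms turns the bound on partial sums into one on their supremum. -/
lemma exp_coe_tsum_le {f : α → ℝ≥0∞} {M : ℝ≥0∞}
    (hM : ∀ F : Finset α, EReal.exp ((∑ y ∈ F, f y : ℝ≥0∞) : EReal) ≤ M) :
    EReal.exp ((∑' y, f y : ℝ≥0∞) : EReal) ≤ M := by
  have hlog : ∀ F : Finset α, ((∑ y ∈ F, f y : ℝ≥0∞) : EReal) ≤ ENNReal.log M := fun F => by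
    rw [← EReal.log_exp ((∑ y ∈ F, f y : ℝ≥0∞) : EReal)]
    exact ENNReal.log_monotone (hM F)
  -- The empty partial sum shows that `log M` is nonnegative, so it can be compared inside `[0, ∞]`.
  have h0 : 0 ≤ ENNReal.log M := by simpa using hlog ∅
  rw [← ENNReal.exp_log M]
  refine EReal.exp_monotone ?_
  rw [← EReal.coe_toENNReal h0, EReal.coe_ennreal_le_coe_ennreal_iff, ENNReal.tsum_eq_iSup_sum]
  refine iSup_le fun F => ?_
  rw [← EReal.coe_ennreal_le_coe_ennreal_iff, EReal.coe_toENNReal h0]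
  exact hlog F

variable {d : ℕ} {G : SimpleGraph (Fin d → ℤ)} {Λ : Set (Fin d → ℤ)}

/-- The exponential of `∑_{y ∈ C(x)} φ(y)` is at most the sum over all finite subsets `S` of the
cluster of `x` of `∏_{y ∈ S} 2 lam φ(y)`. -/
lemma exp_clusterSum_le {lam : ℝ≥0} {φ : Λ → ℝ≥0} (hφ : ∀ y, lam * φ y ≤ 1)
    (ω : Set (Sym2 (Fin d → ℤ))) (x : Λ) :
    EReal.exp (((lam : ℝ≥0∞) * clusterSum G Λ φ ω x : ℝ≥0∞) : EReal) ≤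
      1 + ∑' S : {S : Finset Λ // S.Nonempty},
        (∏ y ∈ S.1, ((2 * lam : ℝ≥0) : ℝ≥0∞) * φ y) * connInd G Λ S.1 x ω := by
  rw [clusterSum, ← ENNReal.tsum_mul_left]
  refine exp_coe_tsum_le fun F => ?_
  have h1 := exp_sum_le (fun y : cluster G Λ ω x => lam * φ y) (fun y => hφ y) F
  simp only [ENNReal.coe_mul] at h1
  refine h1.trans ((prod_one_add_le_tsum _ F).trans ?_)
  gcongr
  let ι : {S : Finset (cluster G Λ ω x) // S.Nonempty} → {S : Finset Λ // S.Nonempty} :=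
    fun S => ⟨S.1.map (Function.Embedding.subtype _), S.2.map⟩
  have hι : Function.Injective ι := fun S T h =>
    Subtype.ext (Finset.map_injective _ (Subtype.ext_iff.1 h))
  refine le_trans (ENNReal.tsum_le_tsum fun S => ?_) (ENNReal.tsum_comp_le_tsum_of_injective hι _)
  rw [connInd_of_subset, mul_one, Finset.prod_map]
  · refine le_of_eq (Finset.prod_congr rfl fun y _ => ?_)
    simp only [Function.Embedding.subtype_apply]
    push_cast
    ring
  · intro y hy
    obtain ⟨z, -, rfl⟩ := Finset.mem_map.1 (Finset.mem_coe.1 hy)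
    exact z.2

lemma lintegral_connInd (p : unitInterval) (S : Finset Λ) (x : Λ) :
    ∫⁻ ω, connInd G Λ S x ω ∂(bondMeasure G p) = bondMeasure G p {ω | ↑S ⊆ cluster G Λ ω x} := by
  rw [← lintegral_indicator_one (measurableSet_subset_cluster S x)]
  rfl

lemma measurable_connInd (S : Finset Λ) (x : Λ) : Measurable (connInd G Λ S x) :=
  Measurable.ite (measurableSet_subset_cluster S x) measurable_const measurable_const

instance (p : unitInterval) : IsProbabilityMeasure (bondMeasure G p) := by
  unfold bondMeasure
  infer_instance

/-- The diagonal term of `h * φ (y)` is already at least `φ y`, because `y` always lies in its own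
cluster. -/
lemma le_one_of_conv_le {p : unitInterval} {φ : Λ → ℝ≥0} {h : Λ → Λ → ℝ≥0}
    (hτ : ∀ x y : Λ, tau G p Λ x y ≤ (h x y : ℝ≥0∞)) (hsup : ⨆ x : Λ, conv h φ x ≤ 1) (y : Λ) :
    φ y ≤ 1 := by
  have hself : tau G p Λ y y = 1 := by
    have : {ω | y ∈ cluster G Λ ω y} = Set.univ :=
      Set.eq_univ_of_forall fun ω => mem_cluster_self _ _
    rw [tau, this, measure_univ]
  have : (φ y : ℝ≥0∞) ≤ 1 := calc
    (φ y : ℝ≥0∞) = tau G p Λ y y * φ y := by rw [hself, one_mul]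
    _ ≤ h y y * φ y := by gcongr; exact hτ y y
    _ ≤ conv h φ y := ENNReal.le_tsum (f := fun z => (h y z : ℝ≥0∞) * (φ z : ℝ≥0∞)) y
    _ ≤ ⨆ x : Λ, conv h φ x := le_iSup _ y
    _ ≤ 1 := hsup
  exact_mod_cast this

end Exponential

end Percolation

/-! ### Choice of the constant and conclusion. -/

theorem mainTheorem9 (C : ℝ≥0) (hC : 0 < C) :
    ∃ lam : ℝ≥0, 0 < lam ∧
      ∀ (d : ℕ) (G : SimpleGraph (Fin d → ℤ)) (p : unitInterval) (Λ : Set (Fin d → ℤ))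
        (φ : Λ → ℝ≥0) (h : Λ → Λ → ℝ≥0),
        (∀ x y : Λ, Percolation.tau G p Λ x y ≤ (h x y : ℝ≥0∞)) →
        (⨆ x : Λ, Percolation.conv h φ x) ≤ 1 →
        (∀ x : Λ, ∑' y : Λ, (h x y : ℝ≥0∞) * (Percolation.conv h φ y) ^ 2
          ≤ (C : ℝ≥0∞) * Percolation.conv h φ x) →
        ∀ x : Λ,
          ∫⁻ ω, EReal.exp
              (((lam : ℝ≥0∞) * Percolation.clusterSum G Λ φ ω x : ℝ≥0∞) : EReal)
            ∂(Percolation.bondMeasure G p)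
          ≤ 1 + Percolation.conv h φ x := by
  -- With `ε = 2 lam`, the first bound is the condition `4εC ≤ 1` of the recursion, and the second
  -- turns `2ε h*φ` into `h*φ`.
  obtain ⟨lam, hlam, hlamC, hlam4⟩ : ∃ lam : ℝ≥0, 0 < lam ∧ 4 * (2 * lam) * C ≤ 1 ∧
      2 * (2 * lam) ≤ 1 := by
    have hpos : 0 < 8 * (C + 1) := by positivity
    have hinv : 8 * (C + 1) * (8 * (C + 1))⁻¹ = 1 := mul_inv_cancel₀ hpos.ne'
    refine ⟨(8 * (C + 1))⁻¹, by positivity, ?_, ?_⟩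
    · calc 4 * (2 * (8 * (C + 1))⁻¹) * C = 8 * C * (8 * (C + 1))⁻¹ := by ring
        _ ≤ 8 * (C + 1) * (8 * (C + 1))⁻¹ := by gcongr; exact le_self_add
        _ = 1 := hinv
    · calc 2 * (2 * (8 * (C + 1))⁻¹) = 4 * 1 * (8 * (C + 1))⁻¹ := by ring
        _ ≤ 8 * (C + 1) * (8 * (C + 1))⁻¹ := by
          gcongr
          · norm_num
          · exact le_add_self
        _ = 1 := hinv
  refine ⟨lam, hlam, fun d G p Λ φ h hτ hsup hconv x => ?_⟩
  have hlam1 : lam ≤ 1 := le_trans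
    (by rw [← mul_assoc]; exact le_mul_of_one_le_left' (by norm_num)) hlam4
  have hφ : ∀ y, lam * φ y ≤ 1 := fun y =>
    mul_le_one' hlam1 (Percolation.le_one_of_conv_le hτ hsup y)
  refine (lintegral_mono fun ω => Percolation.exp_clusterSum_le hφ ω x).trans ?_
  rw [lintegral_add_left measurable_const, lintegral_const, measure_univ, mul_one,
    lintegral_tsum (f := fun (S : {S : Finset Λ // S.Nonempty}) ω =>
      (∏ y ∈ S.1, ((2 * lam : ℝ≥0) : ℝ≥0∞) * φ y) * Percolation.connInd G Λ S.1 x ω)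
      fun S => ((Percolation.measurable_connInd S.1 x).const_mul _).aemeasurable]
  gcongr
  simp only [lintegral_const_mul _ (Percolation.measurable_connInd _ x),
    Percolation.lintegral_connInd]
  refine (Percolation.tsum_prod_mul_bondMeasure_le p hlamC hτ hconv x).trans ?_
  calc 2 * ((2 * lam : ℝ≥0) : ℝ≥0∞) * Percolation.conv h φ x
      = ((2 * (2 * lam) : ℝ≥0) : ℝ≥0∞) * Percolation.conv h φ x := by push_cast; rfl
    _ ≤ 1 * Percolation.conv h φ x := by gcongr; exact_mod_cast hlam4
    _ = Percolation.conv h φ x := one_mul _
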